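/- Let $n\ge 1$ and let $X=(x_{ij})$ be a symmetric $n\times n$ matrix over a field. For $I,J\subseteq\{1,\dots,n\}$ with $|I|=|J|$ let $X_I^J$ be the minor of $X$ with row indices $I$ and column indices $J$, both taken in increasing order (the empty minor is $1$), and set $$p_I=(-1)^{\lfloor |I|/2\rfloor}X_I^I,\qquad a_{ij|I}=(-1)^{\lceil |I|/2\rceil}X_{\{i\}\cup I}^{\{j\}\cup I}\quad(i\ne j,\ i,j\notin I).$$ Let $G_n$ be the plane graph whose nodes are the lattice points $(x,y)$ with $x\ge y\ge 0$ and $x+y\le 2n-2$ even, and whose edges are the northeast steps $(1,1)$ and the southeast steps $(1,-1)$. The point $(2i-2,0)$ is called node $i$. For $i<j$ and $I=\{i+1,\dots,j-1\}$ the point $(i+j-2,\,j-i)$ is labelled $a_{ij|I}$, and the region immediately below it is labelled $p_I$. For $i<j$, a Catalan path $C$ between node $i$ and node $j$ is a path in $G_n$ from node $i$ to node $j$ made of northeast and southeast steps. Its weight $W_{\mathscr C}(C)$ is the product of the labels $a_{kl|I}$ of those points strictly above the $x$-axis that are local maxima or local minima of $C$, divided by the product of the labels $p_I$ of the regions immediately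 below a local maximum or immediately above a local minimum of $C$. Here all local minima of $C$ other than its two end points count, including those on the $x$-axis, which contribute to the denominator but not to the numerator. **Theorem.** The diagonal entries of $X$ are $x_{ii}=p_{\{i\}}$. If $1\le i<j\le n$ and $p_I\neq 0$ for every non-empty set $I$ of consecutive integers contained in $\{i+1,\dots,j-1\}$, then $$x_{ij}=x_{ji}=\sum_{C}W_{\mathscr C}(C),$$ where the sum is over all Catalan paths $C$ between node $i$ and node $j$ in $G_n$. -/

import Mathlib

namespace CatalanMatrix

/-! ### Signed minors.  Rows and columns are indexed by `Fin n`, that is, the index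
`k ∈ {1, …, n}` is the element `k - 1` of `Fin n`. -/

section Minors

variable {K : Type*} [Field K] {n : ℕ}

/-- The minor `X_I^J` with row indices `I` and column indices `J`, `|I| = |J|`, where the indices
in `I` and in `J` are taken in increasing order. -/
def minor (X : Matrix (Fin n) (Fin n) K) (I J : Finset (Fin n)) (h : J.card = I.card) : K :=
  (X.submatrix (I.orderEmbOfFin rfl) (J.orderEmbOfFin h)).det

/-- The signed principal minor `p_I = (-1)^⌊|I|/2⌋ X_I^I`. -/
def principal (X : Matrix (Fin n) (Fin n) K) (I : Finset (Fin n)) : K :=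
  (-1) ^ (I.card / 2) * minor X I I rfl

/-- The signed almost-principal minor `a_{ij|I} = (-1)^⌈|I|/2⌉ X_{iI}^{jI}`, for `i, j ∉ I`. -/
def almostPrincipal (X : Matrix (Fin n) (Fin n) K) (i j : Fin n) (I : Finset (Fin n))
    (hi : i ∉ I) (hj : j ∉ I) : K :=
  (-1) ^ ((I.card + 1) / 2) * minor X (insert i I) (insert j I)
    (by rw [Finset.card_insert_of_notMem hi, Finset.card_insert_of_notMem hj])

end Minors

/-! ### The plane graph `G_n` -/

/-- The nodes of `G_n`, given by their pairs of indices `i ≤ j`; see `Node.pos` for the lattice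
point that belongs to such a pair. -/
abbrev Node (n : ℕ) : Type := {v : Fin n × Fin n // v.1 ≤ v.2}

/-- The position of a node in the plane: with indices counted from `1` the node of `i ≤ j` is at
`(i + j - 2, j - i)`; with indices counted from `0`, as here, it is at `(i + j, j - i)`. -/
def Node.pos {n : ℕ} (v : Node n) : ℤ × ℤ :=
  ((v.1.1 : ℤ) + (v.1.2 : ℤ), (v.1.2 : ℤ) - (v.1.1 : ℤ))

/-- Different pairs give different lattice points. -/
theorem Node.pos_injective {n : ℕ} : Function.Injective (Node.pos (n := n)) := by
  rintro ⟨⟨a, b⟩, h⟩ ⟨⟨c, d⟩, h'⟩ e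
  simp only [Node.pos, Prod.mk.injEq] at e
  simp only [Subtype.mk.injEq, Prod.mk.injEq, Fin.ext_iff]
  omega

/-- The nodes of `G_n` are the lattice points `(x, y)` with `x ≥ y ≥ 0` and `x + y ≤ 2n - 2`
even. -/
theorem Node.range_pos (n : ℕ) : Set.range (Node.pos (n := n)) =
    {p : ℤ × ℤ | 0 ≤ p.2 ∧ p.2 ≤ p.1 ∧ p.1 + p.2 ≤ 2 * (n : ℤ) - 2 ∧ Even (p.1 + p.2)} := by
  ext ⟨x, y⟩
  simp only [Set.mem_range, Set.mem_ofPred_eq]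
  constructor
  · rintro ⟨⟨⟨a, b⟩, h⟩, e⟩
    have h2 : (a : ℕ) ≤ (b : ℕ) := h
    have ha := a.2
    have hb := b.2
    simp only [Node.pos, Prod.mk.injEq] at e
    refine ⟨by omega, by omega, by omega, ⟨(b : ℤ), by omega⟩⟩
  · rintro ⟨h1, h2, h3, ⟨r, hr⟩⟩
    have ha : (x - r).toNat < n := by omega
    have hb : r.toNat < n := by omega
    have hab : (x - r).toNat ≤ r.toNat := by omega
    refine ⟨⟨(⟨(x - r).toNat, ha⟩, ⟨r.toNat, hb⟩), hab⟩, ?_⟩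
    simp only [Node.pos, Prod.mk.injEq]
    omega

/-- The node labelled `i` on the `x`-axis. -/
def axisNode {n : ℕ} (i : Fin n) : Node n := ⟨(i, i), le_rfl⟩

/-- A northeast step `(1, 1)` from `v` to `w`. -/
abbrev NE {n : ℕ} (v w : Node n) : Prop := w.pos = v.pos + (1, 1)

/-- A southeast step `(1, -1)` from `v` to `w`. -/
abbrev SE {n : ℕ} (v w : Node n) : Prop := w.pos = v.pos + (1, -1)

/-! ### Catalan paths in `G_n` and their weights -/

/-- The Catalan paths in `G_n` from node `i` to node `j`, for `i ≤ j`, each given by the sequence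
of the nodes that it visits.  As the two end points have distance `2 (j - i)` and every step
increases the first coordinate by `1`, such a path has exactly `2 (j - i)` steps. -/
def catalanPaths {n : ℕ} (i j : Fin n) :
    Finset (Fin (2 * ((j : ℕ) - (i : ℕ)) + 1) → Node n) :=
  {C | C 0 = axisNode i ∧ C (Fin.last _) = axisNode j ∧
    ∀ k : Fin (2 * ((j : ℕ) - (i : ℕ))),
      NE (C k.castSucc) (C k.succ) ∨ SE (C k.castSucc) (C k.succ)}

/-- The positions at which the path `C` has a local maximum: it arrives by a northeast step and
leaves by a southeast step. -/
def localMaxima {n m : ℕ} (C : Fin (m + 1) → Node n) : Finset (Fin (m + 1)) :=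
  {k | (∃ l : Fin (m + 1), (l : ℕ) + 1 = k ∧ NE (C l) (C k)) ∧
    (∃ l : Fin (m + 1), (k : ℕ) + 1 = l ∧ SE (C k) (C l))}

/-- The positions at which the path `C` has a local minimum: it arrives by a southeast step and
leaves by a northeast step (so the two end points do not count). -/
def localMinima {n m : ℕ} (C : Fin (m + 1) → Node n) : Finset (Fin (m + 1)) :=
  {k | (∃ l : Fin (m + 1), (l : ℕ) + 1 = k ∧ SE (C l) (C k)) ∧
    (∃ l : Fin (m + 1), (k : ℕ) + 1 = l ∧ NE (C k) (C l))}

section Weight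

variable {K : Type*} [Field K] {n : ℕ}

/-- The factor that the node of `i ≤ j` contributes to a numerator: its label `a_{ij|I}` with
`I = {i + 1, …, j - 1}` if it is strictly above the `x`-axis (`i < j`).  The nodes on the axis
carry no minor and contribute nothing, i.e. the factor `1`. -/
def nodeLabel (X : Matrix (Fin n) (Fin n) K) (v : Node n) : K :=
  if v.1.1 < v.1.2 then
    almostPrincipal X v.1.1 v.1.2 (Finset.Ioo v.1.1 v.1.2) (by simp) (by simp)
  else 1

/-- The label `p_I`, `I = {i + 1, …, j - 1}`, of the region immediately below the node of
`i < j`. -/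
def labelBelow (X : Matrix (Fin n) (Fin n) K) (v : Node n) : K :=
  principal X (Finset.Ioo v.1.1 v.1.2)

/-- The label of the region immediately above the node of `i ≤ j`.  This is the region immediately
below the node of `i - 1 < j + 1`, so its label is `p_I` for `I = {i, …, j}`. -/
def labelAbove (X : Matrix (Fin n) (Fin n) K) (v : Node n) : K :=
  principal X (Finset.Icc v.1.1 v.1.2)

/-- The weight of a Catalan path: the product of the labels `a_{ij|I}` of its local maxima and
local minima, divided by the product of the labels `p_I` of the regions immediately below a local
maximum or immediately above a local minimum. -/
def weight {m : ℕ} (X : Matrix (Fin n) (Fin n) K) (C : Fin (m + 1) → Node n) : K :=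
  (∏ k ∈ localMaxima C ∪ localMinima C, nodeLabel X (C k)) /
    ((∏ k ∈ localMaxima C, labelBelow X (C k)) * ∏ k ∈ localMinima C, labelAbove X (C k))

end Weight

end CatalanMatrix

namespace CatalanMatrix

/-! ### Windows of a symmetric matrix: representations, residuals and Cramer's rule -/

section LinearAlgebra

variable {K : Type*} [Field K]

/-! Fix `i` and read the node of `k ≤ l` as the window `[k, l)` of indices. For `i < k ≤ l ≤ j` the
principal block of the window is invertible by hypothesis, so on the columns of the window row `i`
is a unique combination of the rows of the window. Let `U k l` be the first coefficient (`0` for the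
empty window) and `D k l` the residual of row `i` in the next column `l`. These turn out to be the
total weights of the paths from node `i` that arrive at `(k, l)` by a northeast and by a southeast
step, a turn at `(k, l)` itself not yet counted.

A northeast step appends the index `l` to the window and a southeast step removes `k`. Appending
changes the first coefficient by a multiple of the residual (`IsRep.append`); removing changes the
residual by a multiple of the first coefficient (`IsRep.tail`). By Cramer's rule the multipliers are
exactly the quotients `a / p` of a local minimum and of a local maximum at `(k, l)`, while going
straight has factor `1`. So `U` and `D` (`exists_recursion`) obey the same recursion as the path
sums (`pathSum_eq`). At node `j` the window is empty and the residual is `x_ij` itself. -/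

theorem det_mul_apply {m : ℕ} (M : Matrix (Fin (m + 1)) (Fin (m + 1)) K) (v : Fin (m + 1) → K)
    (c : Fin (m + 1)) (h : ∀ q, q ≠ c → (Matrix.vecMul v M) q = 0) (r : Fin (m + 1)) :
    M.det * v r = (Matrix.vecMul v M) c *
      ((-1) ^ (r + c : ℕ) * (M.submatrix r.succAbove c.succAbove).det) := by
  -- Since `v M` is supported at `c`, only one cofactor survives in `(v M) adj M`.
  have h1 : Matrix.vecMul (Matrix.vecMul v M) M.adjugate r = M.det * v r := by
    rw [Matrix.vecMul_vecMul, Matrix.mul_adjugate, Matrix.vecMul_smul, Matrix.vecMul_one]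
    rfl
  rw [← h1, Matrix.vecMul, dotProduct, Finset.sum_eq_single c,
    Matrix.adjugate_fin_succ_eq_det_submatrix]
  · intro q _ hq
    rw [h q hq, zero_mul]
  · simp

/-- The contiguous `m × m` block of `Y` whose upper left entry is at `(r, c)`. -/
def block {K : Type*} (Y : ℕ → ℕ → K) (r c m : ℕ) : Matrix (Fin m) (Fin m) K :=
  Matrix.of fun p q => Y (r + p) (c + q)

/-- On the columns in `[k, l)`, row `i` of `Y` is the combination of the rows in `[k, l)` with
coefficients `β`. -/
def IsRep (Y : ℕ → ℕ → K) (i k l : ℕ) (β : ℕ → K) : Prop :=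
  ∀ c ∈ Finset.Ico k l, ∑ b ∈ Finset.Ico k l, β b * Y b c = Y i c

/-- The entry in column `l` of row `i` minus the combination of the rows in `[k, l)` with
coefficients `β`. -/
def residual (Y : ℕ → ℕ → K) (i k l : ℕ) (β : ℕ → K) : K :=
  Y i l - ∑ b ∈ Finset.Ico k l, β b * Y b l

theorem sum_Ico_eq_sum_fin (k m : ℕ) (f : ℕ → K) :
    ∑ b ∈ Finset.Ico k (k + m), f b = ∑ p : Fin m, f (k + p) := by
  rw [Finset.sum_Ico_eq_sum_range, Nat.add_sub_cancel_left, Finset.sum_range]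

theorem isRep_iff {Y : ℕ → ℕ → K} {i k m : ℕ} {β : ℕ → K} :
    IsRep Y i k (k + m) β ↔
      Matrix.vecMul (fun p : Fin m => β (k + p)) (block Y k k m) = fun q : Fin m => Y i (k + q) := by
  simp only [IsRep, sum_Ico_eq_sum_fin, funext_iff, Matrix.vecMul, dotProduct, block,
    Matrix.of_apply]
  constructor
  · intro h q
    exact h _ (by simp)
  · intro h c hc
    rw [Finset.mem_Ico] at hc
    have := h ⟨c - k, by omega⟩
    simpa [Nat.add_sub_cancel' hc.1] using this

theorem exists_isRep {Y : ℕ → ℕ → K} (i : ℕ) {k m : ℕ} (h : (block Y k k m).det ≠ 0) :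
    ∃ β, IsRep Y i k (k + m) β := by
  set w := Matrix.vecMul (fun q : Fin m => Y i (k + q)) (block Y k k m)⁻¹ with hw
  refine ⟨fun b => if hb : b - k < m then w ⟨b - k, hb⟩ else 0, ?_⟩
  rw [isRep_iff]
  have : (fun p : Fin m => if hb : k + (p : ℕ) - k < m then w ⟨k + p - k, hb⟩ else 0) = w := by
    ext p
    simp
  rw [this, hw, Matrix.vecMul_vecMul, Matrix.nonsing_inv_mul _ (isUnit_iff_ne_zero.2 h),
    Matrix.vecMul_one]

/-- Coefficients obtained by choice can thus be replaced by explicitly updated ones. -/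
theorem IsRep.unique {Y : ℕ → ℕ → K} {i k m : ℕ} (h : (block Y k k m).det ≠ 0) {β β' : ℕ → K}
    (hβ : IsRep Y i k (k + m) β) (hβ' : IsRep Y i k (k + m) β') {b : ℕ}
    (hb : b ∈ Finset.Ico k (k + m)) : β b = β' b := by
  rw [isRep_iff] at hβ hβ'
  have hinj := Matrix.vecMul_injective_of_isUnit
    ((Matrix.isUnit_iff_isUnit_det _).2 (isUnit_iff_ne_zero.2 h))
  have := congrFun (hinj (hβ.trans hβ'.symm)) ⟨b - k, by simp at hb; omega⟩
  simpa [Nat.add_sub_cancel' (Finset.mem_Ico.1 hb).1] using this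

theorem residual_congr {Y : ℕ → ℕ → K} {i k l : ℕ} {β β' : ℕ → K}
    (h : ∀ b ∈ Finset.Ico k l, β b = β' b) : residual Y i k l β = residual Y i k l β' := by
  rw [residual, residual, Finset.sum_congr rfl fun b hb => by rw [h b hb]]

/-- Cramer's rule for the vector `(1, -γ)`: its product with the block vanishes outside the last
column, where it is the residual. The entry `1` is compared. -/
theorem residual_mul_det {Y : ℕ → ℕ → K} {k m : ℕ} {γ : ℕ → K}
    (h : IsRep Y k (k + 1) (k + 1 + m) γ) :
    residual Y k (k + 1) (k + 1 + m) γ * (block Y (k + 1) (k + 1) m).det =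
      (-1) ^ m * (block Y k (k + 1) (m + 1)).det := by
  have key : ∀ q : Fin (m + 1), Matrix.vecMul
      (Fin.cons 1 fun p : Fin m => -γ (k + 1 + p) : Fin (m + 1) → K) (block Y k (k + 1) (m + 1)) q =
      Y k (k + 1 + q) - ∑ p : Fin m, γ (k + 1 + p) * Y (k + 1 + p) (k + 1 + q) := by
    intro q
    simp only [Matrix.vecMul, dotProduct, block, Matrix.of_apply, Fin.sum_univ_succ, Fin.cons_zero,
      Fin.cons_succ, Fin.val_succ, Fin.val_zero, add_zero, one_mul, neg_mul,
      Finset.sum_neg_distrib, sub_eq_add_neg]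
    simp only [add_assoc, add_comm 1]
  have h0 := det_mul_apply (block Y k (k + 1) (m + 1)) (Fin.cons 1 fun p : Fin m => -γ (k + 1 + p))
    (Fin.last m) (by
      intro q hq
      rw [key, ← sum_Ico_eq_sum_fin (k + 1) m fun b => γ b * Y b (k + 1 + q), h, sub_self]
      have := Fin.val_lt_last hq
      simp
      omega) 0
  rw [key, Fin.cons_zero, mul_one, Fin.succAbove_zero, Fin.succAbove_last] at h0
  have hb : (block Y k (k + 1) (m + 1)).submatrix Fin.succ Fin.castSucc =
      block Y (k + 1) (k + 1) m := by
    ext p q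
    simp [block, add_assoc, add_comm 1]
  rw [h0, hb, residual, sum_Ico_eq_sum_fin]
  have : ((-1 : K) ^ m) * (-1) ^ m = 1 := by rw [← mul_pow]; simp
  simp only [Fin.val_last, Fin.val_zero, zero_add]
  linear_combination (-(Y k (k + 1 + m) - ∑ p : Fin m, γ (k + 1 + p) * Y (k + 1 + p) (k + 1 + m)) *
    (block Y (k + 1) (k + 1) m).det) * this

/-- Cramer's rule for the vector `(-δ, 1)`. Its last entry gives the Schur complement formula, its
first entry gives `δ k`; for `m = 0` the first entry is the final `1`. -/
theorem det_block_succ {Y : ℕ → ℕ → K} {k m : ℕ} {δ : ℕ → K}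
    (h : IsRep Y (k + m) k (k + m) δ) :
    (block Y k k (m + 1)).det = residual Y (k + m) k (k + m) δ * (block Y k k m).det ∧
    (block Y k k (m + 1)).det * (if m = 0 then 1 else -δ k) =
      residual Y (k + m) k (k + m) δ * ((-1) ^ m * (block Y (k + 1) k m).det) := by
  set v : Fin (m + 1) → K := Fin.snoc (α := fun _ => K) (fun p : Fin m => -δ (k + p)) 1 with hv
  have key : ∀ q : Fin (m + 1), Matrix.vecMul v (block Y k k (m + 1)) q =
      Y (k + m) (k + q) - ∑ p : Fin m, δ (k + p) * Y (k + p) (k + q) := by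
    intro q
    simp only [Matrix.vecMul, dotProduct, block, Matrix.of_apply, Fin.sum_univ_castSucc, hv,
      Fin.snoc_castSucc, Fin.snoc_last, Fin.val_castSucc, Fin.val_last, neg_mul, one_mul,
      Finset.sum_neg_distrib]
    ring
  have h0 := det_mul_apply (block Y k k (m + 1)) v (Fin.last m) (by
      intro q hq
      rw [key, ← sum_Ico_eq_sum_fin k m fun b => δ b * Y b (k + q), h, sub_self]
      have := Fin.val_lt_last hq
      simp
      omega)
  rw [key] at h0
  rw [residual, sum_Ico_eq_sum_fin]
  constructor
  · have h1 := h0 (Fin.last m)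
    rw [hv, Fin.snoc_last, Fin.succAbove_last, mul_one, ← two_mul, pow_mul] at h1
    simp only [even_two, Even.neg_pow, one_pow, one_mul, Fin.val_last] at h1
    exact h1
  · have h1 := h0 0
    have hv0 : v 0 = if m = 0 then 1 else -δ k := by
      rcases m with _ | m
      · simp [hv, Fin.snoc]
      · simp [hv]
    have hb : (block Y k k (m + 1)).submatrix Fin.succ Fin.castSucc = block Y (k + 1) k m := by
      ext p q
      simp [block, add_assoc, add_comm 1]
    rw [Fin.succAbove_zero, Fin.succAbove_last, hb, hv0] at h1
    simpa using h1

/-! ### Signed minors and the quotients at turns -/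

theorem block_transpose {K : Type*} {Y : ℕ → ℕ → K} (hY : ∀ a b, Y a b = Y b a) (r c m : ℕ) :
    (block Y r c m).transpose = block Y c r m := by
  ext p q
  simp [block, hY (c + p)]

/-- The signed principal minor of the `m` indices from `k` on. -/
def signedPrincipal (Y : ℕ → ℕ → K) (k m : ℕ) : K :=
  (-1) ^ (m / 2) * (block Y k k m).det

/-- The signed almost-principal minor belonging to the end points of `[k, k + m]`. -/
def signedAlmostPrincipal (Y : ℕ → ℕ → K) (k m : ℕ) : K :=
  (-1) ^ (m / 2) * (block Y k (k + 1) m).det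

/-- The signs of the labels are such that their quotient `(-1) ^ m` cancels the cofactor sign in
Cramer's rule. -/
theorem neg_one_pow_half_succ (m : ℕ) : (-1 : K) ^ ((m + 1) / 2) = (-1) ^ m * (-1) ^ (m / 2) := by
  have h : m + m / 2 = (m + 1) / 2 + 2 * (m / 2) := by omega
  rw [← pow_add, h, pow_add, pow_mul]
  simp

/-- The factor of a local maximum at `(k, k + m + 1)`. -/
theorem signedAlmostPrincipal_div_signedPrincipal {Y : ℕ → ℕ → K} {k m : ℕ} {γ : ℕ → K}
    (hdet : (block Y (k + 1) (k + 1) m).det ≠ 0) (h : IsRep Y k (k + 1) (k + 1 + m) γ) :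
    signedAlmostPrincipal Y k (m + 1) / signedPrincipal Y (k + 1) m =
      residual Y k (k + 1) (k + 1 + m) γ := by
  have hs : ((-1 : K) ^ (m / 2)) ≠ 0 := by simp
  rw [signedAlmostPrincipal, signedPrincipal, div_eq_iff (mul_ne_zero hs hdet),
    neg_one_pow_half_succ]
  linear_combination -(-1) ^ (m / 2) * residual_mul_det h

/-- The factor of a local minimum at `(k, k + m)`; `m = 0` is a minimum on the axis, with numerator
`1`. -/
theorem signedAlmostPrincipal_div_signedPrincipal_succ {Y : ℕ → ℕ → K}
    (hY : ∀ a b, Y a b = Y b a) {k m : ℕ} {δ : ℕ → K}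
    (hdet : (block Y k k (m + 1)).det ≠ 0) (h : IsRep Y (k + m) k (k + m) δ) :
    signedAlmostPrincipal Y k m / signedPrincipal Y k (m + 1) =
      (if m = 0 then 1 else -δ k) / residual Y (k + m) k (k + m) δ := by
  have hs : ((-1 : K) ^ ((m + 1) / 2)) ≠ 0 := by simp
  obtain ⟨h1, h2⟩ := det_block_succ h
  have hr : residual Y (k + m) k (k + m) δ ≠ 0 := fun h0 => hdet (by rw [h1, h0, zero_mul])
  -- Cramer's rule gives the minor with rows from `k + 1` and columns from `k`; symmetry turns it
  -- into the label.
  rw [← block_transpose hY k (k + 1) m, Matrix.det_transpose] at h2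
  rw [signedAlmostPrincipal, signedPrincipal, div_eq_div_iff (mul_ne_zero hs hdet) hr,
    neg_one_pow_half_succ]
  have : ((-1 : K) ^ m) * (-1) ^ m = 1 := by rw [← mul_pow]; simp
  linear_combination -((-1) ^ m * (-1) ^ (m / 2)) * h2 - ((-1) ^ (m / 2) *
    (block Y k (k + 1) m).det * residual Y (k + m) k (k + m) δ) * this

/-- Removing the first index: the representation of row `i` is updated with one of row `k`. -/
theorem IsRep.tail {Y : ℕ → ℕ → K} {i k l : ℕ} (hkl : k < l) {β γ : ℕ → K}
    (hβ : IsRep Y i k l β) (hγ : IsRep Y k (k + 1) l γ) :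
    IsRep Y i (k + 1) l (fun b => β b + β k * γ b) ∧
    residual Y i (k + 1) l (fun b => β b + β k * γ b) =
      residual Y i k l β + β k * residual Y k (k + 1) l γ := by
  have hsum : ∀ c, ∑ b ∈ Finset.Ico (k + 1) l, (β b + β k * γ b) * Y b c =
      ∑ b ∈ Finset.Ico k l, β b * Y b c - β k * Y k c +
        β k * ∑ b ∈ Finset.Ico (k + 1) l, γ b * Y b c := by
    intro c
    rw [Finset.sum_eq_sum_Ico_succ_bot hkl, Finset.mul_sum, add_sub_cancel_left,
      ← Finset.sum_add_distrib]
    exact Finset.sum_congr rfl fun b _ => by ring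
  constructor
  · intro c hc
    rw [hsum, hγ c hc, hβ c (by simp at hc ⊢; omega)]
    ring
  · rw [residual, hsum, residual, residual]
    ring

/-- Adding a last index: the representation of row `i` is updated with one of row `l`. -/
theorem IsRep.append {Y : ℕ → ℕ → K} {i k l : ℕ} (hkl : k ≤ l) {β δ : ℕ → K}
    (hβ : IsRep Y i k l β) (hδ : IsRep Y l k l δ) (hr : residual Y l k l δ ≠ 0) :
    IsRep Y i k (l + 1) fun b => (if b = l then 0 else β b) +
      residual Y i k l β / residual Y l k l δ * (if b = l then 1 else -δ b) := by
  -- Row `l` minus its own combination vanishes on the columns in `[k, l)`, so a multiple of it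
  -- clears column `l` without disturbing the others.
  have hsum : ∀ c, ∑ b ∈ Finset.Ico k (l + 1), ((if b = l then 0 else β b) +
      residual Y i k l β / residual Y l k l δ * (if b = l then 1 else -δ b)) * Y b c =
      ∑ b ∈ Finset.Ico k l, β b * Y b c + residual Y i k l β / residual Y l k l δ *
        (Y l c - ∑ b ∈ Finset.Ico k l, δ b * Y b c) := by
    intro c
    rw [Finset.sum_Ico_succ_top hkl, mul_sub, Finset.mul_sum, if_pos rfl, if_pos rfl,
      Finset.sum_congr rfl (g := fun b => β b * Y b c -
        residual Y i k l β / residual Y l k l δ * (δ b * Y b c)), Finset.sum_sub_distrib]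
    · ring
    · intro b hb
      have : b ≠ l := by simp at hb; omega
      rw [if_neg this, if_neg this]
      ring
  intro c hc
  rw [hsum]
  by_cases hcl : c = l
  · subst hcl
    rw [← residual, div_mul_cancel₀ _ hr, residual]
    ring
  · have hc' : c ∈ Finset.Ico k l := by simp at hc ⊢; omega
    rw [hβ c hc', hδ c hc']
    ring

/-- A solution of the recursion that the partial path sums satisfy: `U k l` and `D k l` belong to
paths arriving at `(k, l)` by a northeast and by a southeast step, respectively. -/
theorem exists_recursion {Y : ℕ → ℕ → K} (hY : ∀ a b, Y a b = Y b a) {i j : ℕ} (hij : i < j)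
    (hdet : ∀ k m, i < k → k + m ≤ j → (block Y k k m).det ≠ 0) :
    ∃ U D : ℕ → ℕ → K, (∀ k l, k < i → U k l = 0) ∧ (∀ k l, k ≤ i → D k l = 0) ∧
      (∀ k, U k k = 0) ∧ (∀ l, i < l → U i l = 1) ∧
      (∀ k m, k + m < j → ¬ (k = i ∧ m = 0) → U k (k + m + 1) = U k (k + m) +
        D k (k + m) * (signedAlmostPrincipal Y k m / signedPrincipal Y k (m + 1))) ∧
      (∀ k m, k + 1 + m ≤ j → D (k + 1) (k + 1 + m) = D k (k + 1 + m) + U k (k + 1 + m) *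
        (signedAlmostPrincipal Y k (m + 1) / signedPrincipal Y (k + 1) m)) ∧
      D j j = Y i j := by
  have hex : ∀ k m, ∃ β, i < k → k + m ≤ j → IsRep Y i k (k + m) β := by
    intro k m
    by_cases h : i < k ∧ k + m ≤ j
    · obtain ⟨β, hβ⟩ := exists_isRep i (hdet k m h.1 h.2)
      exact ⟨β, fun _ _ => hβ⟩
    · exact ⟨0, fun h1 h2 => absurd ⟨h1, h2⟩ h⟩
  choose B hB using hex
  -- No path reaches `k < i`, and no northeast step ends on the axis, whence the zeros. The value
  -- `1` at `k = i` is the start of the paths.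
  let U : ℕ → ℕ → K := fun k l =>
    if k < i ∨ l ≤ k then 0 else if k = i then 1 else B k (l - k) k
  let D : ℕ → ℕ → K := fun k l => if k ≤ i then 0 else residual Y i k l (B k (l - k))
  have hU : ∀ k m, i < k → k + m ≤ j → m ≠ 0 → ∀ β, IsRep Y i k (k + m) β → U k (k + m) = β k := by
    intro k m hk hm h0 β hβ
    simp only [U]
    rw [if_neg (by omega), if_neg (by omega), Nat.add_sub_cancel_left]
    exact IsRep.unique (hdet k m hk hm) (hB k m hk hm) hβ (by simp; omega)
  have hD : ∀ k m, i < k → k + m ≤ j → ∀ β, IsRep Y i k (k + m) β →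
      D k (k + m) = residual Y i k (k + m) β := by
    intro k m hk hm β hβ
    simp only [D]
    rw [if_neg (by omega), Nat.add_sub_cancel_left]
    exact residual_congr fun b hb => IsRep.unique (hdet k m hk hm) (hB k m hk hm) hβ hb
  have hUi : ∀ l, i < l → U i l = 1 := fun l hl => by
    simp only [U]
    simp [hl]
  have hU0 : ∀ k l, k < i → U k l = 0 := fun k l hk => if_pos (Or.inl hk)
  have hD0 : ∀ k l, k ≤ i → D k l = 0 := fun k l hk => if_pos hk
  refine ⟨U, D, hU0, hD0, fun k => if_pos (Or.inr le_rfl), hUi, ?_, ?_, ?_⟩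
  · intro k m hm h0
    rcases lt_trichotomy k i with hk | rfl | hk
    · rw [hU0 _ _ hk, hU0 _ _ hk, hD0 _ _ hk.le]
      simp
    · rw [hUi _ (by omega), hUi _ (by omega), hD0 _ _ le_rfl]
      simp
    · obtain ⟨δ, hδ⟩ := exists_isRep (Y := Y) (k + m) (hdet k m hk hm.le)
      have hd := hdet k (m + 1) hk (by omega)
      have hr : residual Y (k + m) k (k + m) δ ≠ 0 := fun h0 =>
        hd (by rw [(det_block_succ hδ).1, h0, zero_mul])
      have hβ := hB k m hk hm.le
      have := hU k (m + 1) hk (by omega) (by omega) _ (hβ.append (by omega) hδ hr)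
      rw [← add_assoc] at this
      rw [this, signedAlmostPrincipal_div_signedPrincipal_succ hY hd hδ, hD k m hk hm.le _ hβ]
      rcases Nat.eq_zero_or_pos m with rfl | hm0
      · have : U k (k + 0) = 0 := if_pos (Or.inr le_rfl)
        rw [this]
        simp [div_eq_mul_inv]
      · rw [hU k m hk hm.le (by omega) _ hβ, if_neg (by omega), if_neg (by omega),
          if_neg (by omega)]
        ring
  · intro k m hm
    rcases lt_or_ge k i with hk | hk
    · rw [hU0 _ _ hk, hD0 _ _ hk.le, hD0 _ _ hk]
      simp
    · obtain ⟨γ, hγ⟩ := exists_isRep (Y := Y) k (hdet (k + 1) m (by omega) hm)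
      rw [signedAlmostPrincipal_div_signedPrincipal (hdet (k + 1) m (by omega) hm) hγ]
      obtain ⟨β, hβ, h1, h2⟩ : ∃ β, IsRep Y i k (k + 1 + m) β ∧ U k (k + 1 + m) = β k ∧
          D k (k + 1 + m) = residual Y i k (k + 1 + m) β := by
        rcases hk.eq_or_lt with rfl | hk
        -- The window contains `i`, so row `i` represents itself, with residual `0`; its block need
        -- not be invertible.
        · refine ⟨Pi.single i 1, fun c _ => ?_, ?_, ?_⟩
          · rw [Finset.sum_eq_single i]
            · simp
            · intro b _ hb
              simp [hb]
            · exact fun hi => absurd (Finset.mem_Ico.2 (by omega)) hi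
          · rw [hUi _ (by omega), Pi.single_eq_same]
          · rw [hD0 _ _ le_rfl, residual, Finset.sum_eq_single i]
            · simp
            · intro b _ hb
              simp [hb]
            · exact fun hi => absurd (Finset.mem_Ico.2 (by omega)) hi
        · have e : k + 1 + m = k + (m + 1) := by ring
          rw [e]
          have hβ := hB k (m + 1) hk (by omega)
          exact ⟨_, hβ, hU k _ hk (by omega) (by omega) _ hβ, hD k _ hk (by omega) _ hβ⟩
      obtain ⟨h3, h4⟩ := hβ.tail (by omega) hγ
      rw [hD (k + 1) m (by omega) hm _ h3, h4, h1, h2]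
  -- For the empty window the residual is the entry itself.
  · have := hD j 0 hij le_rfl 0 (by intro c hc; simp at hc)
    simpa [residual] using this

end LinearAlgebra


/-! ### The labels of `G_n` as signed contiguous minors -/

section Labels

variable {K : Type*} [Field K] {n : ℕ}

/-- The entries of `X` as a function on pairs of natural numbers, with the value `0` outside. -/
def entry (X : Matrix (Fin n) (Fin n) K) (a b : ℕ) : K :=
  if h : a < n ∧ b < n then X ⟨a, h.1⟩ ⟨b, h.2⟩ else 0

@[simp]
theorem entry_val (X : Matrix (Fin n) (Fin n) K) (a b : Fin n) : entry X a b = X a b := by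
  simp [entry]

theorem entry_comm {X : Matrix (Fin n) (Fin n) K} (hX : X.IsSymm) (a b : ℕ) :
    entry X a b = entry X b a := by
  unfold entry
  by_cases h : a < n ∧ b < n
  · rw [dif_pos h, dif_pos h.symm, hX.apply]
  · rw [dif_neg h, dif_neg fun h' => h h'.symm]

theorem card_of_mem_iff {I : Finset (Fin n)} {r m : ℕ} (hn : r + m ≤ n)
    (hI : ∀ x : Fin n, x ∈ I ↔ r ≤ x ∧ (x : ℕ) < r + m) : I.card = m := by
  have : I.map Fin.valEmbedding = Finset.Ico r (r + m) := by
    ext a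
    simp only [Finset.mem_map, Fin.valEmbedding_apply, Finset.mem_Ico, hI]
    exact ⟨by rintro ⟨x, hx, rfl⟩; exact hx, fun ha => ⟨⟨a, by omega⟩, ha, rfl⟩⟩
  rw [← Finset.card_map, this, Nat.card_Ico, Nat.add_sub_cancel_left]

theorem orderEmbOfFin_val {I : Finset (Fin n)} {r m : ℕ} (hn : r + m ≤ n)
    (hI : ∀ x : Fin n, x ∈ I ↔ r ≤ x ∧ (x : ℕ) < r + m) (h : I.card = m) (p : Fin m) :
    (I.orderEmbOfFin h p : ℕ) = r + p := by
  have := Finset.orderEmbOfFin_unique h (f := fun p : Fin m => (⟨r + p, by omega⟩ : Fin n))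
    (fun p => by rw [hI]; simp) (fun p q hpq => Nat.add_lt_add_left hpq r)
  rw [← this]

theorem minor_eq_det_block (X : Matrix (Fin n) (Fin n) K) {I J : Finset (Fin n)}
    (h : J.card = I.card) {r c m : ℕ} (hr : r + m ≤ n) (hc : c + m ≤ n)
    (hI : ∀ x : Fin n, x ∈ I ↔ r ≤ x ∧ (x : ℕ) < r + m)
    (hJ : ∀ x : Fin n, x ∈ J ↔ c ≤ x ∧ (x : ℕ) < c + m) :
    minor X I J h = (block (entry X) r c m).det := by
  obtain rfl := card_of_mem_iff hr hI
  rw [minor]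
  congr 1
  ext p q
  rw [Matrix.submatrix_apply, block, Matrix.of_apply, ← orderEmbOfFin_val hr hI rfl,
    ← orderEmbOfFin_val hc hJ h, entry_val]

theorem principal_eq (X : Matrix (Fin n) (Fin n) K) {I : Finset (Fin n)} {r m : ℕ}
    (hr : r + m ≤ n) (hI : ∀ x : Fin n, x ∈ I ↔ r ≤ x ∧ (x : ℕ) < r + m) :
    principal X I = signedPrincipal (entry X) r m := by
  rw [principal, signedPrincipal, minor_eq_det_block X rfl hr hr hI hI, card_of_mem_iff hr hI]

/-- The signs agree because `⌈(d - 1) / 2⌉ = ⌊d / 2⌋` for `d = l - k ≥ 1`; on the axis the empty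
determinant supplies the factor `1`. -/
theorem nodeLabel_eq (X : Matrix (Fin n) (Fin n) K) (v : Node n) :
    nodeLabel X v = signedAlmostPrincipal (entry X) v.1.1 (v.1.2 - v.1.1) := by
  obtain ⟨⟨k, l⟩, hkl⟩ := v
  simp only [nodeLabel, signedAlmostPrincipal]
  split_ifs with h
  · rw [Fin.lt_def] at h
    rw [almostPrincipal, minor_eq_det_block X (r := k) (c := k + 1) (m := l - k), Fin.card_Ioo]
    · congr 3
      omega
    · omega
    · omega
    · intro x
      simp only [Finset.mem_insert, Finset.mem_Ioo, Fin.ext_iff, Fin.lt_def]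
      omega
    · intro x
      simp only [Finset.mem_insert, Finset.mem_Ioo, Fin.ext_iff, Fin.lt_def]
      omega
  · have : (l : ℕ) - k = 0 := by
      rw [Fin.lt_def] at h
      omega
    rw [this]
    simp

theorem labelBelow_eq (X : Matrix (Fin n) (Fin n) K) {v : Node n} (h : v.1.1 < v.1.2) :
    labelBelow X v = signedPrincipal (entry X) (v.1.1 + 1) (v.1.2 - v.1.1 - 1) := by
  rw [Fin.lt_def] at h
  refine principal_eq X (by omega) fun x => ?_
  simp only [Finset.mem_Ioo, Fin.lt_def]
  omega

theorem labelAbove_eq (X : Matrix (Fin n) (Fin n) K) (v : Node n) :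
    labelAbove X v = signedPrincipal (entry X) v.1.1 (v.1.2 - v.1.1 + 1) := by
  have h := Fin.le_def.1 v.2
  refine principal_eq X (by omega) fun x => ?_
  simp only [Finset.mem_Icc, Fin.le_def]
  omega

theorem apply_self_eq_principal (X : Matrix (Fin n) (Fin n) K) (i : Fin n) :
    X i i = principal X {i} := by
  rw [principal_eq X (r := i) (m := 1) (by omega) (by
    intro x
    simp only [Finset.mem_singleton, Fin.ext_iff]
    omega)]
  simp [signedPrincipal, block]

end Labels

/-! ### Steps of `G_n` in terms of index pairs -/

theorem NE_iff {n : ℕ} {v w : Node n} :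
    NE v w ↔ (w.1.1 : ℕ) = v.1.1 ∧ (w.1.2 : ℕ) = v.1.2 + 1 := by
  simp only [NE, Node.pos, Prod.ext_iff, Prod.fst_add, Prod.snd_add]
  omega

theorem SE_iff {n : ℕ} {v w : Node n} :
    SE v w ↔ (w.1.1 : ℕ) = v.1.1 + 1 ∧ (w.1.2 : ℕ) = v.1.2 := by
  simp only [SE, Node.pos, Prod.ext_iff, Prod.fst_add, Prod.snd_add]
  omega

theorem NE.not_SE {n : ℕ} {v w : Node n} (h : NE v w) : ¬ SE v w := by
  rw [NE_iff] at h
  rw [SE_iff]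
  omega

theorem Node.ext_val {n : ℕ} {v w : Node n} (h1 : (v.1.1 : ℕ) = w.1.1)
    (h2 : (v.1.2 : ℕ) = w.1.2) : v = w :=
  Subtype.ext (Prod.ext (Fin.ext h1) (Fin.ext h2))

/-- A node has at most one predecessor of each kind. The last two hypotheses cover a missing one: no
northeast step ends on the axis, no southeast step on the left border. -/
theorem sum_predecessors {K : Type*} [AddCommMonoid K] {n : ℕ} (v : Node n) (f : Node n → K)
    (c d : K)
    (hNE : ∀ w, NE w v → f w = c) (hSE : ∀ w, SE w v → f w = d)
    (hf : ∀ w, ¬ NE w v → ¬ SE w v → f w = 0)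
    (hc : (v.1.1 : ℕ) = v.1.2 → c = 0) (hd : (v.1.1 : ℕ) = 0 → d = 0) :
    ∑ w, f w = c + d := by
  have hvle := Fin.le_def.1 v.2
  have hsplit : ∀ w, f w = (if NE w v then c else 0) + if SE w v then d else 0 := by
    intro w
    by_cases h1 : NE w v
    · rw [if_pos h1, if_neg (NE.not_SE h1), add_zero, hNE w h1]
    · by_cases h2 : SE w v
      · rw [if_neg h1, if_pos h2, zero_add, hSE w h2]
      · rw [if_neg h1, if_neg h2, add_zero, hf w h1 h2]
  rw [Finset.sum_congr rfl fun w _ => hsplit w, Finset.sum_add_distrib]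
  congr 1
  · by_cases h : (v.1.1 : ℕ) = v.1.2
    · simp [hc h]
    · have hlt : (v.1.2 : ℕ) - 1 < n := by omega
      have hle : v.1.1 ≤ (⟨v.1.2 - 1, hlt⟩ : Fin n) := by
        rw [Fin.le_def]
        simp only
        omega
      rw [Finset.sum_eq_single (⟨(v.1.1, ⟨v.1.2 - 1, hlt⟩), hle⟩ : Node n), if_pos]
      · refine NE_iff.2 ⟨rfl, ?_⟩
        change (v.1.2 : ℕ) = v.1.2 - 1 + 1
        omega
      · intro w _ hw
        refine if_neg fun hwv => hw (Node.ext_val ?_ ?_) <;> rw [NE_iff] at hwv <;> simp only <;>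
          omega
      · simp
  · by_cases h : (v.1.1 : ℕ) = 0
    · simp [hd h]
    · have hlt : (v.1.1 : ℕ) - 1 < n := by omega
      have hle : (⟨v.1.1 - 1, hlt⟩ : Fin n) ≤ v.1.2 := by
        rw [Fin.le_def]
        simp only
        omega
      rw [Finset.sum_eq_single (⟨(⟨v.1.1 - 1, hlt⟩, v.1.2), hle⟩ : Node n), if_pos]
      · refine SE_iff.2 ⟨?_, rfl⟩
        change (v.1.1 : ℕ) = v.1.1 - 1 + 1
        omega
      · intro w _ hw
        refine if_neg fun hwv => hw (Node.ext_val ?_ ?_) <;> rw [SE_iff] at hwv <;> simp only <;>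
          omega
      · simp

/-! ### Path sums by the last step -/

section Paths

variable {K : Type*} [Field K] {n : ℕ}

/-- The factor of the weight of a path that visits `u`, `v`, `w` in turn belonging to `v`. -/
def turnFactor (X : Matrix (Fin n) (Fin n) K) (u v w : Node n) : K :=
  if NE u v ∧ SE v w then nodeLabel X v / labelBelow X v
  else if SE u v ∧ NE v w then nodeLabel X v / labelAbove X v
  else 1

theorem mem_localMaxima_succ {m : ℕ} (C : Fin (m + 2) → Node n) (t : Fin m) :
    t.castSucc.succ ∈ localMaxima C ↔ NE (C t.castSucc.castSucc) (C t.castSucc.succ) ∧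
      SE (C t.castSucc.succ) (C t.succ.succ) := by
  simp only [localMaxima, Finset.mem_filter, Finset.mem_univ, true_and]
  constructor
  · rintro ⟨⟨a, ha, h1⟩, b, hb, h2⟩
    obtain rfl : a = t.castSucc.castSucc := Fin.ext (by simpa using ha)
    obtain rfl : b = t.succ.succ := Fin.ext (by simpa using hb.symm)
    exact ⟨h1, h2⟩
  · rintro ⟨h1, h2⟩
    exact ⟨⟨_, by simp, h1⟩, _, by simp, h2⟩

theorem mem_localMinima_succ {m : ℕ} (C : Fin (m + 2) → Node n) (t : Fin m) :
    t.castSucc.succ ∈ localMinima C ↔ SE (C t.castSucc.castSucc) (C t.castSucc.succ) ∧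
      NE (C t.castSucc.succ) (C t.succ.succ) := by
  simp only [localMinima, Finset.mem_filter, Finset.mem_univ, true_and]
  constructor
  · rintro ⟨⟨a, ha, h1⟩, b, hb, h2⟩
    obtain rfl : a = t.castSucc.castSucc := Fin.ext (by simpa using ha)
    obtain rfl : b = t.succ.succ := Fin.ext (by simpa using hb.symm)
    exact ⟨h1, h2⟩
  · rintro ⟨h1, h2⟩
    exact ⟨⟨_, by simp, h1⟩, _, by simp, h2⟩

theorem zero_notMem_localMaxima {m : ℕ} (C : Fin (m + 1) → Node n) : 0 ∉ localMaxima C := by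
  simp [localMaxima]

theorem zero_notMem_localMinima {m : ℕ} (C : Fin (m + 1) → Node n) : 0 ∉ localMinima C := by
  simp [localMinima]

theorem last_notMem_localMaxima {m : ℕ} (C : Fin (m + 1) → Node n) :
    Fin.last m ∉ localMaxima C := by
  simp only [localMaxima, Finset.mem_filter, Fin.val_last, not_and, not_exists]
  intro _ _ l hl
  omega

theorem last_notMem_localMinima {m : ℕ} (C : Fin (m + 1) → Node n) :
    Fin.last m ∉ localMinima C := by
  simp only [localMinima, Finset.mem_filter, Fin.val_last, not_and, not_exists]
  intro _ _ l hl
  omega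

theorem disjoint_localMaxima_localMinima {m : ℕ} (C : Fin (m + 1) → Node n) :
    Disjoint (localMaxima C) (localMinima C) := by
  rw [Finset.disjoint_left]
  simp only [localMaxima, localMinima, Finset.mem_filter, Finset.mem_univ, true_and]
  rintro k ⟨⟨a, ha, h1⟩, -⟩ ⟨⟨b, hb, h2⟩, -⟩
  obtain rfl : a = b := Fin.ext (by omega)
  exact NE.not_SE h1 h2

/-- The end points are never turns, so the weight is a product of local factors of three consecutive
nodes. Summing over paths then only requires remembering the last two nodes. -/
theorem weight_eq_prod_turnFactor (X : Matrix (Fin n) (Fin n) K) {m : ℕ}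
    (C : Fin (m + 2) → Node n) :
    weight X C = ∏ t : Fin m, turnFactor X (C t.castSucc.castSucc) (C t.castSucc.succ)
      (C t.succ.succ) := by
  have h1 : weight X C = ∏ k, if k ∈ localMaxima C then nodeLabel X (C k) / labelBelow X (C k)
      else if k ∈ localMinima C then nodeLabel X (C k) / labelAbove X (C k) else 1 := by
    rw [weight, Finset.prod_union (disjoint_localMaxima_localMinima C), mul_div_mul_comm,
      ← Finset.prod_div_distrib, ← Finset.prod_div_distrib]
    rw [← Finset.univ_inter (localMaxima C), ← Finset.univ_inter (localMinima C),
      ← Finset.prod_ite_mem, ← Finset.prod_ite_mem, ← Finset.prod_mul_distrib]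
    simp only [Finset.univ_inter]
    refine Finset.prod_congr rfl fun k _ => ?_
    by_cases h : k ∈ localMaxima C
    · simp [h, Finset.disjoint_left.1 (disjoint_localMaxima_localMinima C) h]
    · simp [h]
  rw [h1, Fin.prod_univ_succ, Fin.prod_univ_castSucc, if_neg (zero_notMem_localMaxima C),
    if_neg (zero_notMem_localMinima C), Fin.succ_last, if_neg (last_notMem_localMaxima C),
    if_neg (last_notMem_localMinima C), one_mul, mul_one]
  refine Finset.prod_congr rfl fun t _ => ?_
  simp only [mem_localMaxima_succ, mem_localMinima_succ, turnFactor]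

/-- The paths with `m + 1` steps that start at node `i` and visit `v` and `w` last. -/
def pathsVia (i : Fin n) (m : ℕ) (v w : Node n) : Finset (Fin (m + 2) → Node n) :=
  {C | C 0 = axisNode i ∧ C (Fin.last m).castSucc = v ∧ C (Fin.last (m + 1)) = w ∧
    ∀ k : Fin (m + 1), NE (C k.castSucc) (C k.succ) ∨ SE (C k.castSucc) (C k.succ)}

/-- The sum of the weights of the paths in `pathsVia i m v w`. -/
def pathSum (X : Matrix (Fin n) (Fin n) K) (i : Fin n) (m : ℕ) (v w : Node n) : K :=
  ∑ C ∈ pathsVia i m v w, weight X C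

theorem pathSum_eq_zero (X : Matrix (Fin n) (Fin n) K) (i : Fin n) (m : ℕ) {v w : Node n}
    (h1 : ¬ NE v w) (h2 : ¬ SE v w) : pathSum X i m v w = 0 := by
  refine Finset.sum_eq_zero fun C hC => ?_
  simp only [pathsVia, Finset.mem_filter, Finset.mem_univ, true_and] at hC
  obtain ⟨-, rfl, rfl, h⟩ := hC
  rcases h (Fin.last m) with h | h
  · exact absurd h h1
  · exact absurd h h2

theorem pathSum_zero (X : Matrix (Fin n) (Fin n) K) (i : Fin n) {v w : Node n}
    (h : NE v w ∨ SE v w) : pathSum X i 0 v w = if v = axisNode i then 1 else 0 := by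
  split_ifs with hv
  · have : pathsVia i 0 v w = {![v, w]} := by
      ext C
      simp only [pathsVia, Finset.mem_filter, Finset.mem_univ, true_and, Finset.mem_singleton]
      constructor
      · rintro ⟨-, h1, h2, -⟩
        ext1 k
        fin_cases k
        · exact h1
        · exact h2
      · rintro rfl
        refine ⟨hv, rfl, rfl, fun k => ?_⟩
        fin_cases k
        exact h
    rw [pathSum, this, Finset.sum_singleton, weight_eq_prod_turnFactor]
    simp
  · refine Finset.sum_eq_zero fun C hC => ?_
    simp only [pathsVia, Finset.mem_filter, Finset.mem_univ, true_and] at hC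
    exact absurd (hC.2.1.symm.trans hC.1) hv

/-- Removing the last node is a bijection; whether the path turns at `v` is decided by the step to
`w`. -/
theorem pathSum_succ (X : Matrix (Fin n) (Fin n) K) (i : Fin n) (m : ℕ) {v w : Node n}
    (h : NE v w ∨ SE v w) :
    pathSum X i (m + 1) v w = ∑ u, pathSum X i m u v * turnFactor X u v w := by
  simp only [pathSum, Finset.sum_mul]
  rw [Finset.sum_sigma']
  refine Finset.sum_bij' (fun C _ => ⟨C (Fin.last m).castSucc.castSucc, Fin.init C⟩)
    (fun p _ => Fin.snoc (α := fun _ => Node n) p.2 w) ?_ ?_ ?_ ?_ ?_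
  · intro C hC
    simp only [pathsVia, Finset.mem_filter, Finset.mem_univ, true_and] at hC
    simp only [Finset.mem_sigma, pathsVia, Finset.mem_filter, Finset.mem_univ, true_and]
    exact ⟨hC.1, rfl, hC.2.1, fun k => hC.2.2.2 k.castSucc⟩
  · rintro ⟨u, C⟩ hC
    simp only [Finset.mem_sigma, pathsVia, Finset.mem_filter, Finset.mem_univ, true_and] at hC
    simp only [pathsVia, Finset.mem_filter, Finset.mem_univ, true_and, Fin.snoc_castSucc,
      Fin.snoc_last]
    refine ⟨?_, hC.2.2.1, fun k => ?_⟩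
    · rw [← Fin.castSucc_zero, Fin.snoc_castSucc]
      exact hC.1
    · induction k using Fin.lastCases with
      | last => rw [Fin.succ_last, Fin.snoc_last, hC.2.2.1]; exact h
      | cast k => rw [← Fin.castSucc_succ, Fin.snoc_castSucc]; exact hC.2.2.2 k
  · intro C hC
    simp only [pathsVia, Finset.mem_filter, Finset.mem_univ, true_and] at hC
    simp only [← hC.2.2.1]
    exact Fin.snoc_init_self C
  · rintro ⟨u, C⟩ hC
    simp only [Finset.mem_sigma, pathsVia, Finset.mem_filter, Finset.mem_univ, true_and] at hC
    obtain ⟨-, rfl, -⟩ := hC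
    simp
  · intro C hC
    simp only [pathsVia, Finset.mem_filter, Finset.mem_univ, true_and] at hC
    obtain ⟨-, rfl, rfl, -⟩ := hC
    rw [weight_eq_prod_turnFactor, weight_eq_prod_turnFactor, Fin.prod_univ_castSucc]
    rfl

/-- Induction on the number of steps: each step raises the index sum by one, so `w` determines `m`.
Splitting by the step into `v` reproduces the recursion, a turn at `v` contributing `a / p` and a
straight passage `1`. -/
theorem pathSum_eq (X : Matrix (Fin n) (Fin n) K) (i j : Fin n) {U D : ℕ → ℕ → K}
    (hU0 : ∀ k l, k < (i : ℕ) → U k l = 0) (hD0 : ∀ k l, k ≤ (i : ℕ) → D k l = 0)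
    (hUd : ∀ k, U k k = 0) (hUi : ∀ l, (i : ℕ) < l → U i l = 1)
    (hU : ∀ k m, k + m < (j : ℕ) → ¬ (k = i ∧ m = 0) → U k (k + m + 1) = U k (k + m) +
      D k (k + m) *
        (signedAlmostPrincipal (entry X) k m / signedPrincipal (entry X) k (m + 1)))
    (hD : ∀ k m, k + 1 + m ≤ (j : ℕ) → D (k + 1) (k + 1 + m) = D k (k + 1 + m) +
      U k (k + 1 + m) *
        (signedAlmostPrincipal (entry X) k (m + 1) / signedPrincipal (entry X) (k + 1) m))
    (m : ℕ) (v w : Node n) (hw : (w.1.2 : ℕ) ≤ j) (hm : (w.1.1 : ℕ) + w.1.2 = 2 * i + m + 1) :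
    (NE v w → pathSum X i m v w = U w.1.1 w.1.2) ∧
      (SE v w → pathSum X i m v w = D w.1.1 w.1.2) := by
  induction m generalizing v w with
  | zero =>
    have hv := Fin.le_def.1 v.2
    have hwle := Fin.le_def.1 w.2
    constructor
    · intro h
      rw [pathSum_zero X i (Or.inl h)]
      rw [NE_iff] at h
      split_ifs with hvi
      · subst hvi
        simp only [axisNode] at h
        rw [h.1, hUi _ (by omega)]
      · rw [hU0]
        by_contra hlt
        exact hvi (Node.ext_val (by simp only [axisNode]; omega) (by simp only [axisNode]; omega))
    · intro h
      rw [pathSum_zero X i (Or.inr h)]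
      rw [SE_iff] at h
      rw [hD0 _ _ (by omega), if_neg]
      rintro rfl
      simp only [axisNode] at h
      omega
  | succ m ih =>
    have hv := Fin.le_def.1 v.2
    have hwle := Fin.le_def.1 w.2
    have hd0 : (v.1.1 : ℕ) = 0 → D v.1.1 v.1.2 = 0 := fun h0 => hD0 _ _ (by omega)
    constructor
    · intro h
      have hvw := NE_iff.1 h
      have ih' := fun u => ih u v (by omega) (by omega)
      rw [pathSum_succ X i m (Or.inl h), sum_predecessors v _ (U v.1.1 v.1.2)
        (D v.1.1 v.1.2 * (nodeLabel X v / labelAbove X v))]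
      · have := hU v.1.1 (v.1.2 - v.1.1) (by omega) (by omega)
        rw [nodeLabel_eq, labelAbove_eq, hvw.1, hvw.2]
        rw [Nat.add_sub_cancel' hv] at this
        exact this.symm
      · intro u hu
        rw [(ih' u).1 hu, turnFactor, if_neg fun h' => NE.not_SE h h'.2,
          if_neg fun h' => NE.not_SE hu h'.1, mul_one]
      · intro u hu
        rw [(ih' u).2 hu, turnFactor, if_neg fun h' => NE.not_SE h'.1 hu, if_pos ⟨hu, h⟩]
      · intro u h1 h2
        rw [pathSum_eq_zero X i m h1 h2, zero_mul]
      · intro e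
        rw [e, hUd]
      · intro e
        rw [hd0 e, zero_mul]
    · intro h
      have hvw := SE_iff.1 h
      have ih' := fun u => ih u v (by omega) (by omega)
      have hlt : v.1.1 < v.1.2 := by rw [Fin.lt_def]; omega
      rw [pathSum_succ X i m (Or.inr h), sum_predecessors v _
        (U v.1.1 v.1.2 * (nodeLabel X v / labelBelow X v)) (D v.1.1 v.1.2)]
      · have := hD v.1.1 (v.1.2 - v.1.1 - 1) (by omega)
        rw [show (v.1.1 : ℕ) + 1 + (v.1.2 - v.1.1 - 1) = v.1.2 by omega,
          show (v.1.2 : ℕ) - v.1.1 - 1 + 1 = v.1.2 - v.1.1 by omega] at this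
        rw [nodeLabel_eq, labelBelow_eq X hlt, hvw.1, hvw.2, this, add_comm]
      · intro u hu
        rw [(ih' u).1 hu, turnFactor, if_pos ⟨hu, h⟩]
      · intro u hu
        rw [(ih' u).2 hu, turnFactor, if_neg fun h' => NE.not_SE h'.1 hu,
          if_neg fun h' => NE.not_SE h'.2 h, mul_one]
      · intro u h1 h2
        rw [pathSum_eq_zero X i m h1 h2, zero_mul]
      · intro e
        rw [e, hUd, zero_mul]
      · exact hd0

/-- The paths with `m` steps from node `i` to node `j`. -/
def pathsOfLength (i j : Fin n) (m : ℕ) : Finset (Fin (m + 1) → Node n) :=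
  {C | C 0 = axisNode i ∧ C (Fin.last m) = axisNode j ∧
    ∀ k : Fin m, NE (C k.castSucc) (C k.succ) ∨ SE (C k.castSucc) (C k.succ)}

theorem sum_catalanPaths_eq_sum_pathSum (X : Matrix (Fin n) (Fin n) K) {i j : Fin n} {m : ℕ}
    (hm : 2 * ((j : ℕ) - i) = m + 1) :
    ∑ C ∈ catalanPaths i j, weight X C = ∑ v, pathSum X i m v (axisNode j) := by
  -- The length occurs in the type of the paths; making it a free parameter allows rewriting it as
  -- `m + 1`.
  have h : catalanPaths i j = pathsOfLength i j (2 * ((j : ℕ) - i)) := rfl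
  rw [h, hm, ← Finset.sum_fiberwise _ fun C => C (Fin.last m).castSucc]
  refine Finset.sum_congr rfl fun v _ => Finset.sum_congr ?_ fun _ _ => rfl
  ext C
  simp only [pathsOfLength, pathsVia, Finset.mem_filter, Finset.mem_univ, true_and]
  tauto

theorem sum_weight_catalanPaths {X : Matrix (Fin n) (Fin n) K} (hX : X.IsSymm) {i j : Fin n}
    (hij : i < j)
    (hp : ∀ a b : Fin n, i < a → a ≤ b → b < j → principal X (Finset.Icc a b) ≠ 0) :
    ∑ C ∈ catalanPaths i j, weight X C = X i j := by
  have hlt := Fin.lt_def.1 hij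
  have hdet : ∀ k m, (i : ℕ) < k → k + m ≤ j → (block (entry X) k k m).det ≠ 0 := by
    intro k m hk hm
    rcases Nat.eq_zero_or_pos m with rfl | h0
    · simp
    · have := hp ⟨k, by omega⟩ ⟨k + m - 1, by omega⟩ hk (by rw [Fin.le_def]; simp only; omega)
        (by rw [Fin.lt_def]; simp only; omega)
      rw [principal_eq X (r := k) (m := m) (by omega)] at this
      · exact right_ne_zero_of_mul this
      · intro x
        simp only [Finset.mem_Icc, Fin.le_def]
        omega
  obtain ⟨U, D, hU0, hD0, hUd, hUi, hU, hD, hend⟩ := exists_recursion (entry_comm hX) hlt hdet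
  rw [sum_catalanPaths_eq_sum_pathSum X (m := 2 * ((j : ℕ) - i) - 1) (by omega),
    -- Only a southeast step can end at node `j`, so the whole sum is `D j j`.
    sum_predecessors (axisNode j) _ 0 (X i j)]
  · rw [zero_add]
  · intro v hv
    rw [(pathSum_eq X i j hU0 hD0 hUd hUi hU hD _ v (axisNode j) le_rfl
      (by simp only [axisNode]; omega)).1 hv]
    exact hUd _
  · intro v hv
    rw [(pathSum_eq X i j hU0 hD0 hUd hUi hU hD _ v (axisNode j) le_rfl
      (by simp only [axisNode]; omega)).2 hv]
    exact hend.trans (entry_val X i j)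
  · intro v h1 h2
    exact pathSum_eq_zero X i _ h1 h2
  · simp
  · intro h
    simp only [axisNode] at h
    omega

end Paths

end CatalanMatrix

theorem theorem1 {K : Type*} [Field K] {n : ℕ} (X : Matrix (Fin n) (Fin n) K) (hX : X.IsSymm) :
    (∀ i : Fin n, X i i = CatalanMatrix.principal X {i}) ∧
    ∀ i j : Fin n, i < j →
      (∀ a b : Fin n, i < a → a ≤ b → b < j →
        CatalanMatrix.principal X (Finset.Icc a b) ≠ 0) →
      X i j = ∑ C ∈ CatalanMatrix.catalanPaths i j, CatalanMatrix.weight X C ∧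
      X j i = ∑ C ∈ CatalanMatrix.catalanPaths i j, CatalanMatrix.weight X C := by
  refine ⟨CatalanMatrix.apply_self_eq_principal X, fun i j hij hp => ?_⟩
  rw [CatalanMatrix.sum_weight_catalanPaths hX hij hp]
  exact ⟨rfl, hX.apply i j⟩
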